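/- For a real random variable $\xi$ let $\|\xi\|_{\psi_2}:=\sup_{k\in\mathbb N,\,k\ge1}k^{-1/2}(\mathbb E|\xi|^k)^{1/k}\in[0,\infty]$ denote its sub-Gaussian norm, and let $\|A\|$ denote the spectral norm (the $\ell_2\to\ell_2$ operator norm) of a matrix $A$. There exists an absolute constant $C_0\ge1$ such that for every $K\in[0,\infty)$ there exist constants $C,c>0$, depending only on $K$, with the following property. Let $n\ge1$ be an integer and let $p\in(0,1]$ satisfy $p\ge C_0\frac{\log n}{n}$. Let $A_n$ be the $n\times n$ random matrix with entries $a_{ij}=\delta_{ij}\xi_{ij}$, where $(\delta_{ij})_{i,j\le n}$ and $(\xi_{ij})_{i,j\le n}$ are jointly independent real random variables, $\mathbb P(\delta_{ij}=1)=p=1-\mathbb P(\delta_{ij}=0)$ for all $i,j$, and the $\xi_{ij}$ are identically distributed with $\mathbb E\xi_{ij}=0$ and $\|\xi_{ij}\|_{\psi_2}\le K$. Then \[ \mathbb P\bigl(\|A_n\|\ge C\sqrt{np}\bigr)\le\exp(-c\,np). \] -/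

import Mathlib

open MeasureTheory ProbabilityTheory
open scoped NNReal ENNReal

/-- The sub-Gaussian norm `‖ξ‖_{ψ₂} = sup_{k ≥ 1} k^{-1/2} (𝔼|ξ|^k)^{1/k}` over natural numbers
`k ≥ 1`, with values in `[0, ∞]`; `ξ` is sub-Gaussian when this is finite. -/
noncomputable def subGaussianNorm {Ω : Type*} [MeasurableSpace Ω] (ξ : Ω → ℝ) (μ : Measure Ω) :
    ℝ≥0∞ :=
  ⨆ (k : ℕ) (_ : 1 ≤ k), (k : ℝ≥0∞) ^ (-(1 / 2) : ℝ) * eLpNorm ξ (k : ℝ≥0∞) μ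

/-- The random matrix with entries `δ i j * ξ i j`. -/
def sparseMatrix {Ω : Type*} {n : ℕ} (δ ξ : Fin n → Fin n → Ω → ℝ) (ω : Ω) :
    Matrix (Fin n) (Fin n) ℝ :=
  Matrix.of fun i j => δ i j ω * ξ i j ω

/-- The spectral norm of a real square matrix: its operator norm on Euclidean space. -/
noncomputable def spectralNorm2 {n : ℕ} (A : Matrix (Fin n) (Fin n) ℝ) : ℝ :=
  ‖Matrix.toEuclideanCLM (n := Fin n) (𝕜 := ℝ) A‖

/-! The proof is the moment method, with the sparse matrix compared to a small dense one. For `k` a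
power of two of order `np`, the quantity `‖A‖ ^ (2k)` is at most `tr (A Aᵀ) ^ k`, whose expectation
is a sum over closed walks of length `2k` in the complete bipartite graph on rows and columns.

Walks are grouped by their pattern, that is, by which visits coincide. A pattern with `a` rows, `b`
columns and `E` distinct edges is realised by at most `n ^ (a + b)` walks, each weighing `p ^ E`
times a product of moments of `ξ`. The visited graph is connected, so `a + b ≤ E + 1`, and the
pattern contributes at most `p⁻¹ (np) ^ (a + b)` times the moments. When `np ≤ k` this is at most
`p⁻¹` times the number of realisations of the same pattern in a `2k × 2k` matrix. Hence no walks
have to be enumerated: `sum_walkWeight_le` bounds the sparse trace moment by `p⁻¹ κ ^ (2k)` times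
that of a dense `2k × 2k` matrix with independent entries from a reference law.

The reference law must be centered and sub-Gaussian, and `κ ^ m` times its `m`-th moment must
dominate `|𝔼 ξ ^ m|` for every `m`, odd ones included. This rules out a symmetric law such as the
Gaussian; `exists_centered_subgaussian_law_moment_ge` builds a skewed one. A net argument shows that
the dense matrix has norm of order `√k`, so its trace moment is at most `(const · k) ^ k`
(`sum_walkWeight_le_of_subgaussian`). Markov's inequality then gives the tail; the factor `p⁻¹ ≤ n`
is absorbed because `np ≥ 2 log n`. -/

/-! ### Closed walks in bipartite graphs and the sparse-to-dense comparison -/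

section Walks

open Finset

open scoped Classical in
/-- The number of times the walk `u 0, v 0, u 1, v 1, …, u k` in a complete bipartite graph
traverses the edge `e`. -/
noncomputable def edgeMult {V W : Type*} {k : ℕ} (u : Fin (k + 1) → V) (v : Fin k → W)
    (e : V × W) : ℕ :=
  #{t : Fin k | (u t.castSucc, v t) = e} + #{t : Fin k | (u t.succ, v t) = e}

open scoped Classical in
/-- The weight of a closed walk whose edges have multiplicities `m e`: the product of `φ (m e)`.
Walks that are not closed have weight `0`. -/
noncomputable def walkWeight {V W : Type*} [Fintype V] [Fintype W] (φ : ℕ → ℝ) {k : ℕ}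
    (u : Fin (k + 1) → V) (v : Fin k → W) : ℝ :=
  (if u 0 = u (Fin.last k) then 1 else 0) * ∏ e : V × W, φ (edgeMult u v e)

theorem edgeMult_comp {V W V' W' : Type*} {k : ℕ} (u : Fin (k + 1) → V) (v : Fin k → W)
    (f : V ↪ V') (g : W ↪ W') (e : V × W) :
    edgeMult (f ∘ u) (g ∘ v) (f e.1, g e.2) = edgeMult u v e := by
  unfold edgeMult
  congr 1 <;> (congr 1; ext t; simp [Prod.ext_iff])

theorem edgeMult_comp_of_notMem_range {V W V' W' : Type*} {k : ℕ} (u : Fin (k + 1) → V)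
    (v : Fin k → W) (f : V ↪ V') (g : W ↪ W') (e : V' × W')
    (he : e ∉ Set.range fun e : V × W => (f e.1, g e.2)) :
    edgeMult (f ∘ u) (g ∘ v) e = 0 := by
  simp only [Set.mem_range, not_exists] at he
  simp only [edgeMult, Nat.add_eq_zero_iff, card_eq_zero, filter_eq_empty_iff]
  exact ⟨fun t _ h => he (_, _) h, fun t _ h => he (_, _) h⟩

/-- Edges off the image of the walk have multiplicity `0` and contribute `φ 0 = 1`. The weight
therefore depends only on the pattern of the walk, not on its labels or the ambient graph. -/
theorem walkWeight_comp {V W V' W' : Type*} [Fintype V] [Fintype W] [Fintype V'] [Fintype W']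
    {φ : ℕ → ℝ} (hφ : φ 0 = 1) {k : ℕ} (u : Fin (k + 1) → V) (v : Fin k → W)
    (f : V ↪ V') (g : W ↪ W') :
    walkWeight φ (f ∘ u) (g ∘ v) = walkWeight φ u v := by
  unfold walkWeight
  congr 1
  · by_cases h : u 0 = u (Fin.last k) <;> simp [h]
  · symm
    apply Fintype.prod_of_injective (fun e : V × W => (f e.1, g e.2))
    · rintro ⟨a, b⟩ ⟨c, d⟩ h
      simpa using h
    · intro e he
      rw [edgeMult_comp_of_notMem_range u v f g e he, hφ]
    · intro e
      rw [edgeMult_comp]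

theorem sum_edgeMult {V W : Type*} [Fintype V] [Fintype W] {k : ℕ} (u : Fin (k + 1) → V)
    (v : Fin k → W) : ∑ e, edgeMult u v e = 2 * k := by
  classical
  simp only [edgeMult, sum_add_distrib]
  rw [← card_eq_sum_card_fiberwise (f := fun t : Fin k => (u t.castSucc, v t)) (s := univ)
    (t := univ) (by simp), ← card_eq_sum_card_fiberwise (f := fun t : Fin k => (u t.succ, v t))
    (s := univ) (t := univ) (by simp)]
  simp [two_mul]

/-- A connected graph has at least as many edges as vertices, minus one. -/
theorem card_image_add_card_image_le {V W : Type*} [DecidableEq V] [DecidableEq W]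
    (u : ℕ → V) (v : ℕ → W) (k : ℕ) :
    #((range (k + 1)).image u) + #((range k).image v) ≤
      #((range k).image (fun t => (u t, v t)) ∪ (range k).image (fun t => (u (t + 1), v t))) + 1 := by
  induction k with
  | zero => simp
  | succ k ih =>
    set E := (range k).image (fun t => (u t, v t)) ∪ (range k).image (fun t => (u (t + 1), v t))
      with hE
    have hsub : (range (k + 1)).image (fun t => (u t, v t)) ∪
        (range (k + 1)).image (fun t => (u (t + 1), v t)) =
        insert (u (k + 1), v k) (insert (u k, v k) E) := by
      rw [range_add_one, image_insert, image_insert, hE]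
      ext x; simp only [mem_union, mem_insert]; tauto
    rw [hsub, range_add_one (n := k + 1), image_insert, range_add_one (n := k),
      image_insert (f := v), ← range_add_one]
    -- A new right vertex `v k` makes the edge `(u k, v k)` new, so the edge count keeps pace;
    -- likewise below for a new left vertex `u (k + 1)`.
    have h1 : #(insert (v k) ((range k).image v)) + #E ≤
        #((range k).image v) + #(insert (u k, v k) E) := by
      by_cases h : v k ∈ (range k).image v
      · rw [insert_eq_of_mem h]
        have := card_le_card (subset_insert (u k, v k) E)
        omega
      · have h' : (u k, v k) ∉ E := by
          intro hm
          apply h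
          simp only [hE, mem_union, mem_image, Prod.mk.injEq] at hm ⊢
          rcases hm with ⟨t, ht, -, h⟩ | ⟨t, ht, -, h⟩ <;> exact ⟨t, ht, h⟩
        rw [card_insert_of_notMem h, card_insert_of_notMem h']
        omega
    have h2 : #(insert (u (k + 1)) ((range (k + 1)).image u)) + #(insert (u k, v k) E) ≤
        #((range (k + 1)).image u) + #(insert (u (k + 1), v k) (insert (u k, v k) E)) := by
      by_cases h : u (k + 1) ∈ (range (k + 1)).image u
      · rw [insert_eq_of_mem h]
        have := card_le_card (subset_insert (u (k + 1), v k) (insert (u k, v k) E))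
        omega
      · have h' : (u (k + 1), v k) ∉ insert (u k, v k) E := by
          intro hm
          apply h
          simp only [hE, mem_insert, mem_union, mem_image, Prod.mk.injEq, mem_range] at hm ⊢
          rcases hm with ⟨h, -⟩ | ⟨t, ht, h, -⟩ | ⟨t, ht, h, -⟩
          · exact ⟨k, by omega, h.symm⟩
          · exact ⟨t, by omega, h⟩
          · exact ⟨t + 1, by omega, h⟩
        rw [card_insert_of_notMem h, card_insert_of_notMem h']
        omega
    omega

theorem card_add_card_le_of_surjective {V W : Type*} [Fintype V] [Fintype W] {k : ℕ}
    {u : Fin (k + 1) → V} {v : Fin k → W} (hu : Function.Surjective u)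
    (hv : Function.Surjective v) (hk : k ≠ 0) :
    Fintype.card V + Fintype.card W ≤ #{e | edgeMult u v e ≠ 0} + 1 := by
  classical
  obtain ⟨l, rfl⟩ := Nat.exists_eq_succ_of_ne_zero hk
  have h := card_image_add_card_image_le (fun t => u (Fin.ofNat (l + 1 + 1) t))
    (fun t => v (Fin.ofNat (l + 1) t)) (l + 1)
  have h1 : (range (l + 1 + 1)).image (fun t => u (Fin.ofNat (l + 1 + 1) t)) = univ := by
    ext x
    obtain ⟨t, rfl⟩ := hu x
    simp only [mem_image, mem_range, mem_univ, iff_true]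
    exact ⟨t, t.2, by simp⟩
  have h2 : (range (l + 1)).image (fun t => v (Fin.ofNat (l + 1) t)) = univ := by
    ext x
    obtain ⟨t, rfl⟩ := hv x
    simp only [mem_image, mem_range, mem_univ, iff_true]
    exact ⟨t, t.2, by simp⟩
  rw [h1, h2, card_univ, card_univ] at h
  refine h.trans (Nat.add_le_add_right (card_le_card ?_) 1)
  intro e he
  simp only [mem_union, mem_image, mem_range] at he
  simp only [mem_filter, mem_univ, true_and, edgeMult, ne_eq, Nat.add_eq_zero_iff, card_eq_zero,
    filter_eq_empty_iff]
  rintro ⟨ha, hb⟩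
  rcases he with ⟨t, ht, h⟩ | ⟨t, ht, h⟩
  · refine ha (x := ⟨t, ht⟩) trivial ?_
    rw [← h]
    congr 2 <;> ext <;> simp [Nat.mod_eq_of_lt ht, Nat.mod_eq_of_lt (ht.trans (Nat.lt_succ_self _))]
  · refine hb (x := ⟨t, ht⟩) trivial ?_
    rw [← h]
    congr 2 <;> ext <;> simp [Nat.mod_eq_of_lt ht, Nat.mod_eq_of_lt (Nat.succ_lt_succ ht)]

/-- A function is the same as its kernel together with an embedding of the quotient. -/
noncomputable def sigmaQuotientEmbeddingEquivFun (I V : Type*) :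
    (Σ π : Setoid I, (Quotient π ↪ V)) ≃ (I → V) :=
  Equiv.ofBijective (fun x => x.2 ∘ Quotient.mk x.1) <| by
    -- The kernel of the composite recovers the setoid because the second factor is injective; this
    -- gives injectivity of the correspondence.
    have h (x : Σ π : Setoid I, (Quotient π ↪ V)) :
        Setoid.ker (x.2 ∘ Quotient.mk x.1) = x.1 := by
      ext a b
      simp [Setoid.ker_def, Quotient.eq]
    refine ⟨fun x y hxy => ?_, fun f => ⟨⟨Setoid.ker f, ⟨Setoid.kerLift f,
      Setoid.kerLift_injective f⟩⟩, rfl⟩⟩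
    have hker : x.1 = y.1 := by rw [← h x, ← h y]; exact congrArg Setoid.ker hxy
    obtain ⟨π, f⟩ := x
    obtain ⟨σ, g⟩ := y
    obtain rfl : π = σ := hker
    congr 1
    ext q
    induction q using Quotient.inductionOn with
    | h a => exact congrFun hxy a

instance {I : Type*} [Finite I] : Finite (Setoid I) :=
  Finite.of_injective (fun π : Setoid I => (π : I → I → Prop)) fun _ _ h =>
    Setoid.ext fun a b => iff_of_eq (congrFun (congrFun h a) b)

/-- A sum over all functions, grouped by their kernels. -/
theorem sum_fun_eq_sum_setoid {I V : Type*} [Fintype I] [DecidableEq I] [Fintype V]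
    [Fintype (Setoid I)] [∀ π : Setoid I, Fintype (Quotient π)] (G : (I → V) → ℝ) (g : Setoid I → ℝ)
    (h : ∀ (π : Setoid I) (f : Quotient π ↪ V), G (f ∘ Quotient.mk π) = g π) :
    ∑ u, G u = ∑ π : Setoid I,
      ((Fintype.card V).descFactorial (Fintype.card (Quotient π)) : ℝ) * g π := by
  classical
  rw [← (sigmaQuotientEmbeddingEquivFun I V).sum_comp, Fintype.sum_sigma]
  refine sum_congr rfl fun π _ => ?_
  have h' (f : Quotient π ↪ V) : G (sigmaQuotientEmbeddingEquivFun I V ⟨π, f⟩) = g π := h π f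
  rw [sum_congr rfl fun f _ => h' f, sum_const, card_univ, Fintype.card_embedding_eq, nsmul_eq_mul]

theorem walkWeight_nonneg {V W : Type*} [Fintype V] [Fintype W] {ψ : ℕ → ℝ} (hψ : ∀ m, 0 ≤ ψ m)
    {k : ℕ} (u : Fin (k + 1) → V) (v : Fin k → W) : 0 ≤ walkWeight ψ u v := by
  unfold walkWeight
  refine mul_nonneg ?_ (prod_nonneg fun e _ => hψ _)
  split_ifs <;> simp

/-- If `φ m` is at most `p * κ ^ m * ψ m`, then the weight of a walk has a factor `p` for each
edge. -/
theorem walkWeight_le {V W : Type*} [Fintype V] [Fintype W] {φ ψ : ℕ → ℝ} {p κ : ℝ}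
    (hφ : φ 0 = 1) (hψ : ψ 0 = 1)
    (hle : ∀ m ≠ 0, |φ m| ≤ p * κ ^ m * ψ m) {k : ℕ} (u : Fin (k + 1) → V) (v : Fin k → W) :
    walkWeight φ u v ≤ p ^ #{e | edgeMult u v e ≠ 0} * κ ^ (2 * k) * walkWeight ψ u v := by
  have key : ∏ e : V × W, φ (edgeMult u v e) ≤
      p ^ #{e | edgeMult u v e ≠ 0} * κ ^ (2 * k) * ∏ e : V × W, ψ (edgeMult u v e) := by
    calc ∏ e : V × W, φ (edgeMult u v e) ≤ ∏ e : V × W, |φ (edgeMult u v e)| := by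
          rw [← abs_prod]; exact le_abs_self _
      _ ≤ ∏ e : V × W, ((if edgeMult u v e ≠ 0 then p else 1) * κ ^ edgeMult u v e *
            ψ (edgeMult u v e)) := by
          refine prod_le_prod (fun _ _ => abs_nonneg _) fun e _ => ?_
          split_ifs with h
          · exact hle _ h
          · rw [not_not] at h
            simp [h, hφ, hψ]
      _ = _ := by
          rw [prod_mul_distrib, prod_mul_distrib, prod_pow_eq_pow_sum, sum_edgeMult, ← prod_filter,
            prod_const]
  unfold walkWeight
  split_ifs
  · simpa using key
  · simp

/-- A pattern is a pair of setoids, and its labellings are pairs of embeddings of the quotients. The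
size of the vertex set enters only through descending factorials, so sums over different graphs can
be compared pattern by pattern. -/
theorem sum_walkWeight_eq_sum_setoid {T : Type*} [Fintype T] {χ : ℕ → ℝ} (hχ : χ 0 = 1) {k : ℕ}
    [Fintype (Setoid (Fin (k + 1)))] [Fintype (Setoid (Fin k))]
    [∀ π : Setoid (Fin (k + 1)), Fintype (Quotient π)] [∀ π : Setoid (Fin k), Fintype (Quotient π)] :
    ∑ u : Fin (k + 1) → T, ∑ v : Fin k → T, walkWeight χ u v =
      ∑ π : Setoid (Fin (k + 1)), ∑ σ : Setoid (Fin k),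
        ((Fintype.card T).descFactorial (Fintype.card (Quotient π)) : ℝ) *
        (((Fintype.card T).descFactorial (Fintype.card (Quotient σ)) : ℝ) *
          walkWeight χ (Quotient.mk π) (Quotient.mk σ)) := by
  rw [sum_fun_eq_sum_setoid _ (fun π => ∑ σ : Setoid (Fin k),
        (((Fintype.card T).descFactorial (Fintype.card (Quotient σ)) : ℝ) *
          walkWeight χ (Quotient.mk π) (Quotient.mk σ)))]
  · simp_rw [mul_sum]
  · intro π f
    rw [sum_fun_eq_sum_setoid]
    intro σ g
    exact walkWeight_comp hχ _ _ f g

/-- Comparison of the weighted number of closed walks in a large graph with that in a small one. -/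
theorem sum_walkWeight_le {V R : Type*} [Fintype V] [Fintype R] {φ ψ : ℕ → ℝ} {p κ : ℝ}
    (hp : 0 < p) (hp1 : p ≤ 1) (hφ : φ 0 = 1) (hψ : ψ 0 = 1) (hψn : ∀ m, 0 ≤ ψ m)
    (hle : ∀ m ≠ 0, |φ m| ≤ p * κ ^ m * ψ m) {k : ℕ} (hk : k ≠ 0)
    (hV : Fintype.card V * p ≤ k) (hR : Fintype.card R = 2 * k) :
    ∑ u : Fin (k + 1) → V, ∑ v : Fin k → V, walkWeight φ u v ≤
      p⁻¹ * κ ^ (2 * k) * ∑ u : Fin (k + 1) → R, ∑ v : Fin k → R, walkWeight ψ u v := by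
  classical
  have : Fintype (Setoid (Fin (k + 1))) := Fintype.ofFinite _
  have : Fintype (Setoid (Fin k)) := Fintype.ofFinite _
  rw [sum_walkWeight_eq_sum_setoid hφ, sum_walkWeight_eq_sum_setoid hψ, mul_sum]
  refine sum_le_sum fun π _ => ?_
  rw [mul_sum]
  refine sum_le_sum fun σ _ => ?_
  -- A vertex set of size `2k` is large enough that, while up to `k + 1` distinct labels are chosen
  -- in turn, at least `k ≥ card V * p` choices remain each time.
  have hcount (a : ℕ) (ha : a ≤ k + 1) :
      ((Fintype.card V).descFactorial a : ℝ) * p ^ a ≤ ((Fintype.card R).descFactorial a : ℝ) := by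
    calc ((Fintype.card V).descFactorial a : ℝ) * p ^ a ≤ (Fintype.card V : ℝ) ^ a * p ^ a := by
          gcongr
          exact_mod_cast Nat.descFactorial_le_pow _ _
      _ = (Fintype.card V * p) ^ a := (mul_pow _ _ _).symm
      _ ≤ (k : ℝ) ^ a := by gcongr
      _ ≤ ((2 * k + 1 - a : ℕ) : ℝ) ^ a := by gcongr; omega
      _ ≤ _ := by rw [hR]; exact_mod_cast Nat.pow_sub_le_descFactorial _ _
  have hπ : Fintype.card (Quotient π) ≤ k + 1 := by
    simpa using Fintype.card_le_of_surjective (Quotient.mk π) Quotient.mk_surjective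
  have hσ : Fintype.card (Quotient σ) ≤ k + 1 := by
    have := Fintype.card_le_of_surjective (Quotient.mk σ) Quotient.mk_surjective
    rw [Fintype.card_fin] at this
    omega
  have hedges := card_add_card_le_of_surjective (Quotient.mk_surjective (s := π))
    (Quotient.mk_surjective (s := σ)) hk
  set E := #{e | edgeMult (Quotient.mk π) (Quotient.mk σ) e ≠ 0}
  set a := Fintype.card (Quotient π)
  set b := Fintype.card (Quotient σ)
  -- Connectedness and `p ≤ 1`: one factor `p` per vertex can be taken from the edges, at the cost
  -- of a single `p⁻¹`.
  have hpow : p ^ E ≤ p⁻¹ * (p ^ a * p ^ b) := by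
    rw [← pow_add, le_inv_mul_iff₀ hp, ← pow_succ']
    exact pow_le_pow_of_le_one hp.le hp1 hedges
  have hw := walkWeight_nonneg hψn (Quotient.mk π) (Quotient.mk σ)
  have hκ : 0 ≤ κ ^ (2 * k) := by rw [pow_mul]; positivity
  calc ((Fintype.card V).descFactorial a : ℝ) * (((Fintype.card V).descFactorial b : ℝ) *
        walkWeight φ (Quotient.mk π) (Quotient.mk σ))
      ≤ ((Fintype.card V).descFactorial a : ℝ) * (((Fintype.card V).descFactorial b : ℝ) *
        (p ^ E * κ ^ (2 * k) * walkWeight ψ (Quotient.mk π) (Quotient.mk σ))) := by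
        gcongr
        exact walkWeight_le hφ hψ hle _ _
    _ ≤ ((Fintype.card V).descFactorial a : ℝ) * (((Fintype.card V).descFactorial b : ℝ) *
        (p⁻¹ * (p ^ a * p ^ b) * κ ^ (2 * k) *
          walkWeight ψ (Quotient.mk π) (Quotient.mk σ))) := by
        gcongr
    _ = p⁻¹ * κ ^ (2 * k) * ((((Fintype.card V).descFactorial a : ℝ) * p ^ a) *
        ((((Fintype.card V).descFactorial b : ℝ) * p ^ b) *
          walkWeight ψ (Quotient.mk π) (Quotient.mk σ))) := by ring
    _ ≤ _ := by
        gcongr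
        · exact hcount a hπ
        · exact hcount b hσ

end Walks

/-! ### Traces as sums over closed walks -/

section Trace

open Finset Matrix

theorem Matrix.pow_apply_eq_sum_walk {V R : Type*} [Fintype V] [DecidableEq V] [CommRing R]
    (M : Matrix V V R) (k : ℕ) (i j : V) :
    (M ^ k) i j = ∑ u : Fin (k + 1) → V, (if u 0 = i ∧ u (Fin.last k) = j then 1 else 0) *
      ∏ t : Fin k, M (u t.castSucc) (u t.succ) := by
  induction k generalizing i with
  | zero =>
    rw [← (Equiv.funUnique (Fin 1) V).symm.sum_comp]
    simp [Matrix.one_apply, ite_and]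
  | succ k ih =>
    rw [pow_succ', Matrix.mul_apply, ← (Fin.consEquiv fun _ => V).sum_comp, Fintype.sum_prod_type]
    rw [sum_eq_single_of_mem i (mem_univ i) fun x _ hx => sum_eq_zero fun u _ => by simp [hx]]
    simp only [ih, mul_sum]
    rw [sum_comm]
    refine sum_congr rfl fun u _ => ?_
    rw [sum_eq_single_of_mem (u 0) (mem_univ _) fun x _ hx => by simp [hx.symm]]
    simp only [Fin.consEquiv_apply, Fin.prod_univ_succ, Fin.castSucc_zero, Fin.cons_zero,
      ← Fin.succ_castSucc, Fin.cons_succ, ← Fin.succ_last, true_and]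
    ring

theorem prod_comp_eq_prod_pow {ι κ R : Type*} [Fintype ι] [Fintype κ] [DecidableEq κ] [CommMonoid R]
    (f : κ → R) (g : ι → κ) : ∏ t, f (g t) = ∏ e, f e ^ #{t | g t = e} := by
  rw [← prod_fiberwise (s := univ) (g := g)]
  refine prod_congr rfl fun e _ => ?_
  rw [prod_congr rfl fun t ht => congrArg f (mem_filter.1 ht).2, prod_const]

theorem Matrix.trace_mul_transpose_pow_eq_sum {V : Type*} [Fintype V] [DecidableEq V]
    (X : Matrix V V ℝ) (k : ℕ) :
    trace ((X * Xᵀ) ^ k) = ∑ u : Fin (k + 1) → V, ∑ v : Fin k → V,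
      (if u 0 = u (Fin.last k) then 1 else 0) * ∏ e : V × V, X e.1 e.2 ^ edgeMult u v e := by
  classical
  simp only [trace, diag_apply, Matrix.pow_apply_eq_sum_walk]
  rw [sum_comm]
  refine sum_congr rfl fun u _ => ?_
  rw [← mul_sum, ← sum_mul]
  congr 1
  · simp [ite_and, eq_comm]
  · simp only [Matrix.mul_apply, transpose_apply, prod_univ_sum]
    refine sum_congr (by simp) fun v _ => ?_
    simp only [edgeMult, pow_add, prod_mul_distrib]
    congr 1
    · rw [prod_comp_eq_prod_pow (fun e : V × V => X e.1 e.2) fun t : Fin k => (u t.castSucc, v t)]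
      congr!
    · rw [prod_comp_eq_prod_pow (fun e : V × V => X e.1 e.2) fun t : Fin k => (u t.succ, v t)]
      congr!

/-- The expected trace of `(X Xᵀ) ^ k` when the entries of `X` have multiplicative mixed moments,
the moments being `φ`. -/
theorem integral_trace_mul_transpose_pow {V Ω : Type*} [Fintype V] [DecidableEq V]
    [MeasurableSpace Ω] {μ : Measure Ω} {X : Ω → Matrix V V ℝ} {φ : ℕ → ℝ}
    (hint : ∀ m : V × V → ℕ, Integrable (fun ω => ∏ e : V × V, X ω e.1 e.2 ^ m e) μ)
    (hmom : ∀ m : V × V → ℕ, ∫ ω, ∏ e : V × V, X ω e.1 e.2 ^ m e ∂μ = ∏ e, φ (m e)) (k : ℕ) :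
    Integrable (fun ω => trace ((X ω * (X ω)ᵀ) ^ k)) μ ∧
    ∫ ω, trace ((X ω * (X ω)ᵀ) ^ k) ∂μ =
      ∑ u : Fin (k + 1) → V, ∑ v : Fin k → V, walkWeight φ u v := by
  simp only [Matrix.trace_mul_transpose_pow_eq_sum]
  refine ⟨integrable_finsetSum _ fun u _ => integrable_finsetSum _ fun v _ =>
    (hint _).const_mul _, ?_⟩
  rw [integral_finsetSum _ fun u _ => integrable_finsetSum _ fun v _ => (hint _).const_mul _]
  refine sum_congr rfl fun u _ => ?_
  rw [integral_finsetSum _ fun v _ => (hint _).const_mul _]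
  refine sum_congr rfl fun v _ => ?_
  rw [integral_const_mul, hmom, walkWeight]
  congr!

end Trace

/-! ### Spectral norm against traces of powers -/

section Norm

open Matrix
theorem spectralNorm2_sq_le_sum_sq {n : ℕ} (A : Matrix (Fin n) (Fin n) ℝ) :
    spectralNorm2 A ^ 2 ≤ ∑ i, ∑ j, A i j ^ 2 := by
  have h0 : 0 ≤ ∑ i, ∑ j, A i j ^ 2 := by positivity
  rw [spectralNorm2, ← Real.le_sqrt (norm_nonneg _) h0]
  refine ContinuousLinearMap.opNorm_le_bound _ (Real.sqrt_nonneg _) fun x => ?_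
  rw [← abs_of_nonneg (norm_nonneg (toEuclideanCLM (n := Fin n) (𝕜 := ℝ) A x)),
    ← abs_of_nonneg (mul_nonneg (Real.sqrt_nonneg _) (norm_nonneg x)), ← sq_le_sq, mul_pow,
    Real.sq_sqrt h0, EuclideanSpace.norm_sq_eq, EuclideanSpace.norm_sq_eq, Finset.sum_mul]
  refine Finset.sum_le_sum fun i _ => ?_
  simpa [Matrix.mulVec, dotProduct] using
    Finset.sum_mul_sq_le_sq_mul_sq Finset.univ (A i) x.ofLp

theorem spectralNorm2_mul_transpose {n : ℕ} (A : Matrix (Fin n) (Fin n) ℝ) :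
    spectralNorm2 (A * Aᵀ) = spectralNorm2 A ^ 2 := by
  rw [← conjTranspose_eq_transpose_of_trivial, ← star_eq_conjTranspose, spectralNorm2, map_mul,
    map_star, sq]
  exact CStarRing.norm_self_mul_star

/-- For self-adjoint `M = A Aᵀ` the norm of `M ^ 2 ^ s` is exactly `‖M‖ ^ 2 ^ s`, and the trace of
the square of this symmetric matrix is its squared Frobenius norm. Powers of two suffice, and they
avoid eigenvalues. -/
theorem spectralNorm2_pow_le_trace {n : ℕ} (A : Matrix (Fin n) (Fin n) ℝ) (s : ℕ) :
    spectralNorm2 A ^ (2 * 2 ^ (s + 1)) ≤ trace ((A * Aᵀ) ^ (2 ^ (s + 1))) := by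
  set T := toEuclideanCLM (n := Fin n) (𝕜 := ℝ)
  have hM : IsSelfAdjoint (T (A * Aᵀ)) := by
    rw [← conjTranspose_eq_transpose_of_trivial, ← star_eq_conjTranspose]
    exact (IsSelfAdjoint.mul_star_self A).map T
  have h2 : spectralNorm2 ((A * Aᵀ) ^ 2 ^ s) = (spectralNorm2 A ^ 2) ^ 2 ^ s := by
    rw [← spectralNorm2_mul_transpose, spectralNorm2, map_pow]
    exact hM.norm_pow_two_pow s
  calc spectralNorm2 A ^ (2 * 2 ^ (s + 1)) = spectralNorm2 ((A * Aᵀ) ^ 2 ^ s) ^ 2 := by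
        rw [h2]; ring
    _ ≤ _ := spectralNorm2_sq_le_sum_sq _
    _ = trace ((A * Aᵀ) ^ (2 ^ (s + 1))) := by
        have hs : ((A * Aᵀ) ^ 2 ^ s)ᵀ = (A * Aᵀ) ^ 2 ^ s := by
          rw [transpose_pow, transpose_mul, transpose_transpose]
        rw [pow_succ, pow_mul, sq]
        simp only [trace, diag_apply, Matrix.mul_apply (M := (A * Aᵀ) ^ 2 ^ s)]
        refine Finset.sum_congr rfl fun i _ => Finset.sum_congr rfl fun j _ => ?_
        rw [sq, ← transpose_apply ((A * Aᵀ) ^ 2 ^ s) i j, hs]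

theorem trace_le_card_mul_spectralNorm2 {n : ℕ} (A : Matrix (Fin n) (Fin n) ℝ) :
    trace A ≤ n * spectralNorm2 A := by
  have h (i : Fin n) : A i i ≤ spectralNorm2 A := by
    have := inner_toEuclideanCLM A (EuclideanSpace.single i 1) (EuclideanSpace.single i 1)
    simp only [PiLp.ofLp_single, mulVec_single_one, single_dotProduct, col_apply, one_mul] at this
    rw [← this]
    refine (real_inner_le_norm _ _).trans ?_
    refine (mul_le_mul_of_nonneg_left (ContinuousLinearMap.le_opNorm _ _) (norm_nonneg _)).trans ?_
    simp [spectralNorm2]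
  simpa [trace] using Finset.sum_le_sum fun i (_ : i ∈ Finset.univ) => h i

theorem trace_mul_transpose_pow_le {n : ℕ} (A : Matrix (Fin n) (Fin n) ℝ) (k : ℕ) (hk : k ≠ 0) :
    trace ((A * Aᵀ) ^ k) ≤ n * spectralNorm2 A ^ (2 * k) := by
  refine (trace_le_card_mul_spectralNorm2 _).trans ?_
  gcongr
  rw [pow_mul]
  rw [← spectralNorm2_mul_transpose, spectralNorm2, map_pow]
  exact norm_pow_le' _ (Nat.pos_of_ne_zero hk)

end Norm

/-! ### Nets and the operator norm -/

section Net

/-- The ball of radius `2` has a `1`-net of at most `5 ^ dim` points. -/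
theorem exists_finset_net (E : Type*) [NormedAddCommGroup E] [NormedSpace ℝ E]
    [FiniteDimensional ℝ E] :
    ∃ s : Finset E, (∀ c ∈ s, ‖c‖ ≤ 2) ∧ s.card ≤ 5 ^ Module.finrank ℝ E ∧
      ∀ x, ‖x‖ ≤ 2 → ∃ c ∈ s, ‖x - c‖ ≤ 1 := by
  classical
  by_contra! hcon
  -- If no admissible set were a net, a separated set of any size could be built greedily, against
  -- the packing bound.
  have h (N : ℕ) : ∃ s : Finset E, s.card = N ∧ (∀ c ∈ s, ‖c‖ ≤ 2) ∧
      ∀ c ∈ s, ∀ d ∈ s, c ≠ d → 1 ≤ ‖c - d‖ := by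
    induction N with
    | zero => exact ⟨∅, by simp⟩
    | succ N ih =>
      obtain ⟨s, hs, h2, hsep⟩ := ih
      obtain ⟨x, hx, hxs⟩ := hcon s h2 (Besicovitch.card_le_of_separated s h2 hsep)
      have hxn : x ∉ s := fun hmem => by
        have := hxs x hmem
        simp at this
        linarith
      refine ⟨insert x s, by rw [Finset.card_insert_of_notMem hxn, hs], ?_, ?_⟩
      · simpa using ⟨hx, h2⟩
      · intro c hc d hd hcd
        rcases Finset.mem_insert.1 hc with hc' | hc' <;>
          rcases Finset.mem_insert.1 hd with hd' | hd'
        · exact absurd (hc'.trans hd'.symm) hcd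
        · rw [hc']; exact (hxs d hd').le
        · rw [hd', norm_sub_rev]; exact (hxs c hc').le
        · exact hsep c hc' d hd' hcd
  obtain ⟨s, hs, h2, hsep⟩ := h (5 ^ Module.finrank ℝ E + 1)
  have := Besicovitch.card_le_of_separated s h2 hsep
  omega

/-- For `‖y‖ = 2`, approximation by the net gives `‖f y‖ ≤ M + ‖f‖`, hence `2 ‖f‖ ≤ M + ‖f‖`. Radius
`2` with mesh `1` thus loses no constant. -/
theorem ContinuousLinearMap.opNorm_le_of_net {E F : Type*} [NormedAddCommGroup E] [NormedSpace ℝ E]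
    [NormedAddCommGroup F] [NormedSpace ℝ F] (f : E →L[ℝ] F) {s : Finset E}
    (hs : ∀ x, ‖x‖ ≤ 2 → ∃ c ∈ s, ‖x - c‖ ≤ 1) {M : ℝ} (hM : ∀ c ∈ s, ‖f c‖ ≤ M) : ‖f‖ ≤ M := by
  have hM0 : 0 ≤ M := by
    obtain ⟨c, hc, -⟩ := hs 0 (by simp)
    exact (norm_nonneg _).trans (hM c hc)
  have h : ‖f‖ ≤ (M + ‖f‖) / 2 := by
    refine f.opNorm_le_bound (by positivity) fun x => ?_
    rcases eq_or_ne x 0 with rfl | hx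
    · simp
    have hx' : 0 < ‖x‖ := norm_pos_iff.2 hx
    set y := (2 / ‖x‖) • x with hy
    have hyn : ‖y‖ = 2 := by
      rw [hy, norm_smul, Real.norm_of_nonneg (by positivity)]
      field_simp
    obtain ⟨c, hc, hyc⟩ := hs y hyn.le
    have hfy : ‖f y‖ ≤ M + ‖f‖ := by
      calc ‖f y‖ = ‖f c + f (y - c)‖ := by rw [← map_add, add_sub_cancel]
        _ ≤ ‖f c‖ + ‖f (y - c)‖ := norm_add_le _ _
        _ ≤ M + ‖f‖ * 1 := add_le_add (hM c hc) ((f.le_opNorm _).trans (by gcongr))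
        _ = M + ‖f‖ := by ring
    have hxy : ‖f x‖ = ‖x‖ / 2 * ‖f y‖ := by
      rw [hy, map_smul, norm_smul, Real.norm_of_nonneg (by positivity)]
      field_simp
    rw [hxy]
    calc ‖x‖ / 2 * ‖f y‖ ≤ ‖x‖ / 2 * (M + ‖f‖) := by gcongr
      _ = _ := by ring
  linarith

theorem spectralNorm2_le_of_net {r : ℕ} (B : Matrix (Fin r) (Fin r) ℝ)
    {s : Finset (EuclideanSpace ℝ (Fin r))} (hs : ∀ x, ‖x‖ ≤ 2 → ∃ c ∈ s, ‖x - c‖ ≤ 1) {M : ℝ}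
    (hM : ∀ x ∈ s, ∀ y ∈ s, |∑ e : Fin r × Fin r, x e.1 * y e.2 * B e.1 e.2| ≤ M) :
    spectralNorm2 B ≤ M := by
  unfold spectralNorm2
  refine ContinuousLinearMap.opNorm_le_of_net _ hs fun y hy => ?_
  rw [← innerSL_apply_norm (𝕜 := ℝ)]
  refine ContinuousLinearMap.opNorm_le_of_net _ hs fun x hx => ?_
  rw [innerSL_apply_apply, Real.norm_eq_abs, real_inner_comm, Matrix.inner_toEuclideanCLM]
  convert hM x hx y hy using 2
  simp only [dotProduct, Matrix.mulVec, Finset.mul_sum, Fintype.sum_prod_type]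
  exact Finset.sum_congr rfl fun i _ => Finset.sum_congr rfl fun j _ => by ring

/-- A union bound at the level of moments: the maximum over the net, raised to the power `2k`, is at
most the sum. It is applied with `M` the `2k`-th root of that sum. -/
theorem pow_le_sum_sum_pow_of_forall_abs_le {α : Type*} (s : Finset α) (F : α → α → ℝ) {a : ℝ}
    (ha : 0 ≤ a) (h : ∀ M, (∀ x ∈ s, ∀ y ∈ s, |F x y| ≤ M) → a ≤ M) {k : ℕ} (hk : k ≠ 0) :
    a ^ (2 * k) ≤ ∑ x ∈ s, ∑ y ∈ s, F x y ^ (2 * k) := by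
  have hnn (z : ℝ) : 0 ≤ z ^ (2 * k) := (even_two_mul k).pow_nonneg z
  set S := ∑ x ∈ s, ∑ y ∈ s, F x y ^ (2 * k)
  have hS0 : 0 ≤ S := Finset.sum_nonneg fun x _ => Finset.sum_nonneg fun y _ => hnn _
  have hMS : (S ^ (((2 * k : ℕ) : ℝ)⁻¹)) ^ (2 * k) = S := Real.rpow_inv_natCast_pow hS0 (by omega)
  rw [← hMS]
  refine pow_le_pow_left₀ ha (h _ fun x hx y hy => ?_) _
  refine le_of_pow_le_pow_left₀ (n := 2 * k) (by omega) (by positivity) ?_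
  rw [hMS, (even_two_mul k).pow_abs]
  exact (Finset.single_le_sum (f := fun y => F x y ^ (2 * k)) (fun _ _ => hnn _) hy).trans
    (Finset.single_le_sum (f := fun x => ∑ y ∈ s, F x y ^ (2 * k))
      (fun _ _ => Finset.sum_nonneg fun _ _ => hnn _) hx)

end Net

/-! ### Sub-Gaussian moments and a criterion for sub-Gaussianity -/

section SubGaussian

/-- One term of the exponential series bounds `(t |z|) ^ (2k) / (2k)!` by `exp (t |z|)`. The
parameter `t` stays free to be optimised later. -/
theorem ProbabilityTheory.HasSubgaussianMGF.integral_pow_le {Ω : Type*} [MeasurableSpace Ω]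
    {μ : Measure Ω} {Z : Ω → ℝ} {c : ℝ≥0} (hZ : HasSubgaussianMGF Z c μ) (k : ℕ) {t : ℝ}
    (ht : 0 < t) :
    ∫ ω, Z ω ^ (2 * k) ∂μ ≤ (2 * k).factorial / t ^ (2 * k) * (2 * Real.exp (c * t ^ 2 / 2)) := by
  have hpt (z : ℝ) : z ^ (2 * k) ≤
      (2 * k).factorial / t ^ (2 * k) * (Real.exp (t * z) + Real.exp (-t * z)) := by
    have h1 : (t * |z|) ^ (2 * k) / (2 * k).factorial ≤ Real.exp (t * |z|) :=
      Real.pow_div_factorial_le_exp _ (by positivity) _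
    have h2 : Real.exp (t * |z|) ≤ Real.exp (t * z) + Real.exp (-t * z) := by
      rcases abs_cases z with ⟨h, -⟩ | ⟨h, -⟩ <;> rw [h]
      · linarith [Real.exp_pos (-t * z)]
      · rw [mul_neg, ← neg_mul]; linarith [Real.exp_pos (t * z)]
    have h3 := h1.trans h2
    rw [mul_pow, (even_two_mul k).pow_abs, div_le_iff₀ (by positivity)] at h3
    rw [div_mul_eq_mul_div, le_div_iff₀ (by positivity)]
    linarith
  have hi := (hZ.integrable_exp_mul t).add (hZ.integrable_exp_mul (-t))
  calc ∫ ω, Z ω ^ (2 * k) ∂μ ≤ ∫ ω, (2 * k).factorial / t ^ (2 * k) *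
        (Real.exp (t * Z ω) + Real.exp (-t * Z ω)) ∂μ :=
        integral_mono_of_nonneg (ae_of_all _ fun ω => (even_two_mul k).pow_nonneg _)
          (hi.const_mul _) (ae_of_all _ fun ω => hpt _)
    _ = (2 * k).factorial / t ^ (2 * k) * (mgf Z μ t + mgf Z μ (-t)) := by
        rw [integral_const_mul, integral_add (hZ.integrable_exp_mul t)
          (hZ.integrable_exp_mul (-t))]
        rfl
    _ ≤ _ := by
        have h1 := hZ.mgf_le t
        have h2 := hZ.mgf_le (-t)
        rw [neg_sq] at h2
        gcongr
        linarith

theorem exp_le_one_add_add_sq_mul_exp_abs (y : ℝ) :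
    Real.exp y ≤ 1 + y + y ^ 2 * Real.exp |y| := by
  have h := Complex.norm_exp_sub_sum_le_norm_mul_exp (y : ℂ) 2
  rw [show Complex.exp (y : ℂ) - ∑ m ∈ Finset.range 2, (y : ℂ) ^ m / m.factorial =
    ((Real.exp y - (1 + y) : ℝ) : ℂ) by simp [Finset.sum_range_succ], Complex.norm_real,
    Complex.norm_real, Real.norm_eq_abs, Real.norm_eq_abs, sq_abs] at h
  linarith [(abs_le.1 h).2]

/-- A centered random variable with `exp (X ^ 2)` integrable is sub-Gaussian. -/
theorem exists_hasSubgaussianMGF_of_integrable_exp_sq {Ω : Type*} [MeasurableSpace Ω]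
    {μ : Measure Ω} [IsProbabilityMeasure μ] {X : Ω → ℝ} (hX : AEMeasurable X μ)
    (hexp : Integrable (fun ω => Real.exp (X ω ^ 2)) μ) (hint : Integrable X μ)
    (h0 : ∫ ω, X ω ∂μ = 0) : ∃ c : ℝ≥0, HasSubgaussianMGF X c μ := by
  set M := ∫ ω, Real.exp (X ω ^ 2) ∂μ with hM
  have hM0 : 0 ≤ M := integral_nonneg fun ω => (Real.exp_pos _).le
  have hpt (t x : ℝ) : Real.exp (t * x) ≤ Real.exp (t ^ 2 / 4) * Real.exp (x ^ 2) := by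
    rw [← Real.exp_add]
    apply Real.exp_le_exp.2
    nlinarith [sq_nonneg (t / 2 - x)]
  have hi (t : ℝ) : Integrable (fun ω => Real.exp (t * X ω)) μ := by
    refine (hexp.const_mul (Real.exp (t ^ 2 / 4))).mono' ?_ (ae_of_all _ fun ω => ?_)
    · exact (Real.measurable_exp.comp_aemeasurable (hX.const_mul t)).aestronglyMeasurable
    · rw [Real.norm_of_nonneg (Real.exp_pos _).le]
      exact hpt _ _
  refine ⟨⟨8 * M + 2, by positivity⟩, hi, fun t => ?_⟩
  rw [mgf]
  change _ ≤ Real.exp ((8 * M + 2) * t ^ 2 / 2)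
  -- For small `t` the linear Taylor term vanishes by centering, leaving `1 + O(t ^ 2)`. For large
  -- `t` the crude bound `t x ≤ t ^ 2 / 4 + x ^ 2` suffices, since constants are then at most
  -- multiples of `t ^ 2`.
  rcases le_total |t| 1 with ht | ht
  · have hpt' (x : ℝ) : Real.exp (t * x) ≤ 1 + t * x + 4 * t ^ 2 * Real.exp (x ^ 2) := by
      refine (exp_le_one_add_add_sq_mul_exp_abs _).trans ?_
      -- Half of the exponent `x ^ 2` pays for `exp |t x|`, the other half for the factor `x ^ 2`.
      have h1 : Real.exp |t * x| ≤ Real.exp (1 / 2) * Real.exp (x ^ 2 / 2) := by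
        rw [← Real.exp_add, abs_mul]
        apply Real.exp_le_exp.2
        nlinarith [sq_nonneg (|x| - 1), sq_abs x, abs_nonneg x,
          mul_le_mul_of_nonneg_right ht (abs_nonneg x)]
      have h2 : x ^ 2 ≤ 2 * Real.exp (x ^ 2 / 2) := by
        linarith [Real.add_one_le_exp (x ^ 2 / 2)]
      have h3 : Real.exp (1 / 2) ≤ 2 := by
        have : Real.exp (1 / 2) ^ 2 ≤ 2 ^ 2 := by
          rw [← Real.exp_nat_mul]
          norm_num
          linarith [Real.exp_one_lt_d9]
        exact le_of_pow_le_pow_left₀ (by norm_num) (by norm_num) this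
      have h4 : Real.exp (x ^ 2 / 2) * Real.exp (x ^ 2 / 2) = Real.exp (x ^ 2) := by
        rw [← Real.exp_add]; ring_nf
      have h5 : x ^ 2 * Real.exp |t * x| ≤ 4 * Real.exp (x ^ 2) := by
        calc x ^ 2 * Real.exp |t * x| ≤
            (2 * Real.exp (x ^ 2 / 2)) * (2 * Real.exp (x ^ 2 / 2)) := by
              gcongr
              exact h1.trans (by gcongr)
          _ = _ := by rw [← h4]; ring
      rw [mul_pow, mul_assoc (t ^ 2)]
      nlinarith [mul_le_mul_of_nonneg_left h5 (sq_nonneg t)]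
    calc ∫ ω, Real.exp (t * X ω) ∂μ ≤
          ∫ ω, (1 + t * X ω + 4 * t ^ 2 * Real.exp (X ω ^ 2)) ∂μ :=
          integral_mono (hi t) (((integrable_const _).add (hint.const_mul _)).add
            (hexp.const_mul _)) fun ω => hpt' _
      _ = 1 + 4 * t ^ 2 * M := by
          have hsum : Integrable (fun ω => 1 + t * X ω) μ :=
            (integrable_const _).add (hint.const_mul _)
          rw [integral_add hsum (hexp.const_mul _),
            integral_add (integrable_const _) (hint.const_mul _), integral_const_mul,
            integral_const_mul, h0]
          simp [hM]
      _ ≤ Real.exp (4 * t ^ 2 * M) := by linarith [Real.add_one_le_exp (4 * t ^ 2 * M)]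
      _ ≤ _ := Real.exp_le_exp.2 (by nlinarith [sq_nonneg t])
  · have ht2 : 1 ≤ t ^ 2 := by rw [← sq_abs]; nlinarith
    calc ∫ ω, Real.exp (t * X ω) ∂μ ≤ ∫ ω, Real.exp (t ^ 2 / 4) * Real.exp (X ω ^ 2) ∂μ :=
          integral_mono (hi t) (hexp.const_mul _) fun ω => hpt _ _
      _ = Real.exp (t ^ 2 / 4) * M := integral_const_mul _ _
      _ ≤ Real.exp (t ^ 2 / 4) * Real.exp M := by
          gcongr
          linarith [Real.add_one_le_exp M]
      _ ≤ _ := by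
          rw [← Real.exp_add]
          apply Real.exp_le_exp.2
          nlinarith

end SubGaussian

/-! ### The reference law -/

section ReferenceLaw

/-- There is a centered sub-Gaussian law, all of whose moments are positive and as large as those of
a Gaussian law, up to the scale. -/
theorem exists_centered_subgaussian_law_moment_ge :
    ∃ (ν : Measure ℝ) (c : ℝ≥0), IsProbabilityMeasure ν ∧ HasSubgaussianMGF id c ν ∧
      ∫ x, x ∂ν = 0 ∧ ∀ m : ℕ, 2 ≤ m → (√m / 16) ^ m ≤ ∫ x, x ^ m ∂ν := by
  -- Atoms at `√(j + 1)` with weights `8 ^ (-(j + 1))`: the tail is Gaussian, `exp (x ^ 2)` is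
  -- integrable because `e < 8`, and the atom `j = m - 1` alone gives the `m`-th moment the required
  -- size. The remaining mass `6 / 7` sits at `-a`, with `a` chosen to centre the law.
  set w : ℕ → ℝ := fun j => (1 / 8) ^ (j + 1) with hw
  have hw0 (j : ℕ) : 0 ≤ w j := by positivity
  set y : ℕ → ℝ := fun j => √((j : ℝ) + 1) with hy
  have hy1 (j : ℕ) : 1 ≤ y j := by
    rw [hy, Real.one_le_sqrt]; linarith [(Nat.cast_nonneg j : (0 : ℝ) ≤ j)]
  have hwsum : HasSum w (1 / 7) := by
    have h := (hasSum_geometric_of_lt_one (r := (1 / 8 : ℝ)) (by norm_num) (by norm_num)).mul_left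
      (1 / 8)
    have e : (fun j : ℕ => (1 / 8 : ℝ) * (1 / 8) ^ j) = w := by
      funext j
      exact (pow_succ' _ _).symm
    rw [e] at h
    rw [show (1 / 7 : ℝ) = 1 / 8 * (1 - 1 / 8)⁻¹ by norm_num]
    exact h
  have hexp : Summable fun j => w j * Real.exp (y j ^ 2) := by
    have : Summable fun j : ℕ => (Real.exp 1 / 8) ^ (j + 1) :=
      (summable_nat_add_iff 1).2 (summable_geometric_of_lt_one (by positivity)
        (by linarith [Real.exp_one_lt_d9]))
    convert this using 1
    ext j
    rw [hy, Real.sq_sqrt (by positivity), hw, div_pow, ← Real.exp_nat_mul]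
    push_cast
    rw [one_div, inv_pow, mul_one]
    ring
  have hmoment (m : ℕ) : Summable fun j => w j * y j ^ m := by
    refine Summable.of_nonneg_of_le (fun j => mul_nonneg (hw0 j) (by positivity)) (fun j => ?_)
      (hexp.mul_left (m.factorial : ℝ))
    have h1 : y j ^ m ≤ (y j ^ 2) ^ m := by
      rw [← pow_mul]; exact pow_le_pow_right₀ (hy1 j) (by omega)
    have h2 := Real.pow_div_factorial_le_exp (y j ^ 2) (by positivity) m
    rw [div_le_iff₀ (by positivity)] at h2
    calc w j * y j ^ m ≤ w j * (Real.exp (y j ^ 2) * m.factorial) := by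
          gcongr
          exact h1.trans h2
      _ = _ := by ring
  set S : ℕ → ℝ := fun m => ∑' j, w j * y j ^ m with hS
  set a : ℝ := 7 / 6 * S 1 with ha
  have ha0 : 0 ≤ a := by
    have : 0 ≤ S 1 := tsum_nonneg fun j => mul_nonneg (hw0 j) (by positivity)
    positivity
  have ha1 : a ≤ 1 / 2 := by
    have h1 : HasSum (fun j : ℕ => (j : ℝ) * (1 / 8) ^ j) ((1 / 8) / (1 - 1 / 8) ^ 2) :=
      hasSum_coe_mul_geometric_of_norm_lt_one (by norm_num)
    have h2 : HasSum (fun j : ℕ => ((j + 1 : ℕ) : ℝ) * (1 / 8) ^ (j + 1))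
        ((1 / 8) / (1 - 1 / 8) ^ 2) := by
      rw [hasSum_nat_add_iff (f := fun j : ℕ => (j : ℝ) * (1 / 8) ^ j) 1]
      simpa using h1
    have h3 : S 1 ≤ (1 / 8) / (1 - 1 / 8) ^ 2 := by
      rw [← h2.tsum_eq]
      refine (hmoment 1).tsum_le_tsum (fun j => ?_) h2.summable
      rw [pow_one, mul_comm]
      push_cast
      gcongr
      rw [Real.sqrt_le_left (by positivity)]
      nlinarith [(Nat.cast_nonneg j : (0 : ℝ) ≤ j)]
    rw [ha]
    norm_num at h3 ⊢
    linarith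
  set ρ : Measure ℝ := Measure.sum fun j => ENNReal.ofReal (w j) • Measure.dirac (y j) with hρ
  set ν : Measure ℝ := ENNReal.ofReal (6 / 7) • Measure.dirac (-a) + ρ with hν
  have hρint (f : ℝ → ℝ) (hf : Summable fun j => w j * |f (y j)|) : Integrable f ρ := by
    refine integrable_sum_dirac (fun _ => ENNReal.ofReal_ne_top) ?_
    simpa only [ENNReal.toReal_ofReal (hw0 _), Real.norm_eq_abs] using hf
  have hδint (f : ℝ → ℝ) : Integrable f (ENNReal.ofReal (6 / 7) • Measure.dirac (-a)) :=
    (integrable_dirac (by simp)).smul_measure ENNReal.ofReal_ne_top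
  have hνint (f : ℝ → ℝ) (hf : Summable fun j => w j * |f (y j)|) : Integrable f ν :=
    (hδint f).add_measure (hρint f hf)
  have hνeq (f : ℝ → ℝ) (hf : Summable fun j => w j * |f (y j)|) :
      ∫ x, f x ∂ν = 6 / 7 * f (-a) + ∑' j, w j * f (y j) := by
    rw [hν, integral_add_measure (hδint f) (hρint f hf), integral_smul_measure, integral_dirac,
      hρ, integral_sum_dirac (fun _ => ENNReal.ofReal_ne_top)]
    simp only [ENNReal.toReal_ofReal (hw0 _), smul_eq_mul]
    rw [ENNReal.toReal_ofReal (by norm_num)]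
  have hprob : IsProbabilityMeasure ν := by
    constructor
    have h1 : ∑' j, ENNReal.ofReal (w j) = ENNReal.ofReal (1 / 7) := by
      rw [← ENNReal.ofReal_tsum_of_nonneg hw0 hwsum.summable, hwsum.tsum_eq]
    simp only [hν, hρ, Measure.add_apply, Measure.smul_apply, measure_univ, smul_eq_mul, mul_one,
      Measure.sum_apply _ MeasurableSet.univ, h1]
    rw [← ENNReal.ofReal_add (by norm_num) (by norm_num)]
    norm_num
  have habs (m : ℕ) : Summable fun j => w j * |y j ^ m| := by
    convert hmoment m using 3
    exact abs_of_nonneg (by positivity)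
  have hmean : ∫ x, x ∂ν = 0 := by
    rw [hνeq (fun x => x) (by simpa using habs 1)]
    have : ∑' j, w j * y j = S 1 := by simp [hS]
    rw [this, ha]
    ring
  obtain ⟨c, hc⟩ := exists_hasSubgaussianMGF_of_integrable_exp_sq (μ := ν) (X := id)
    aemeasurable_id (hνint _ (by simpa using hexp)) (hνint _ (by simpa using habs 1)) hmean
  refine ⟨ν, c, hprob, hc, hmean, fun m hm => ?_⟩
  rw [hνeq (fun x => x ^ m) (habs m)]
  have hS1 : S 1 ≤ S m := by
    refine (hmoment 1).tsum_le_tsum (fun j => ?_) (hmoment m)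
    gcongr
    · exact hy1 j
    · omega
  have hterm : (1 / 8) ^ m * √m ^ m ≤ S m := by
    have h := (hmoment m).le_tsum (m - 1) fun j _ => mul_nonneg (hw0 j) (by positivity)
    have hcast : (((m - 1 : ℕ) : ℝ) + 1) = m := by
      rw [← Nat.cast_succ]; congr 1; omega
    simpa only [hw, hy, hcast, Nat.sub_add_cancel (by omega : 1 ≤ m)] using h
  -- As `a ≤ 1 / 2`, the negative atom cancels at most half of the positive part, even for odd `m`.
  have hneg : 6 / 7 * a ^ m ≤ S 1 / 2 := by
    obtain ⟨l, rfl⟩ : ∃ l, m = l + 2 := ⟨m - 2, by omega⟩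
    have h1 : a ^ (l + 1) ≤ 1 / 2 := by
      rw [pow_succ]
      have : a ^ l ≤ 1 := pow_le_one₀ ha0 (by linarith)
      nlinarith
    have h2 : S 1 = 6 / 7 * a := by rw [ha]; ring
    rw [h2, pow_succ]
    nlinarith
  have hneg' : -(a ^ m) ≤ (-a) ^ m := by
    have := neg_abs_le ((-a) ^ m)
    rwa [abs_pow, abs_neg, abs_of_nonneg ha0] at this
  have h16 : (√m / 16) ^ m ≤ (1 / 8) ^ m * √m ^ m / 2 := by
    have h2 : (1 / 2 : ℝ) ^ m ≤ 1 / 2 := by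
      calc (1 / 2 : ℝ) ^ m ≤ (1 / 2) ^ 1 :=
            pow_le_pow_of_le_one (by norm_num) (by norm_num) (by omega)
        _ = _ := by norm_num
    calc (√m / 16) ^ m = (1 / 2) ^ m * ((1 / 8) ^ m * √m ^ m) := by
          rw [← mul_pow, ← mul_pow]; ring
      _ ≤ 1 / 2 * ((1 / 8) ^ m * √m ^ m) := by gcongr
      _ = _ := by ring
  have : ∑' j, w j * y j ^ m = S m := rfl
  linarith

end ReferenceLaw

/-! ### Trace moments of the dense reference matrix -/

section Dense

open Matrix

/-- The walk sum is the expected trace for a `2k × 2k` matrix with independent entries of law `ν`.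
The trace is at most `2k ‖X‖ ^ (2k)`, and the norm is controlled by bilinear forms over a net. The
net's `25 ^ (2k)` pairs cost only a constant to the power `k`, since dimension and moment order are
comparable. -/
theorem sum_walkWeight_le_of_subgaussian {ν : Measure ℝ} [IsProbabilityMeasure ν] {c : ℝ≥0}
    (hν : HasSubgaussianMGF id c ν) {k : ℕ} (hk : k ≠ 0) :
    ∑ u : Fin (k + 1) → Fin (2 * k), ∑ v : Fin k → Fin (2 * k),
      walkWeight (fun m => ∫ x, x ^ m ∂ν) u v ≤ (10000 * Real.exp (8 * c) * k) ^ k := by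
  set r := 2 * k
  set μ : Measure (Fin r × Fin r → ℝ) := Measure.pi fun _ => ν with hμ
  set X : (Fin r × Fin r → ℝ) → Matrix (Fin r) (Fin r) ℝ := fun ω => Matrix.of fun i j => ω (i, j)
    with hX
  have hpow (m : ℕ) : Integrable (fun x : ℝ => x ^ m) ν := by
    have := (hν.memLp m).integrable_norm_pow'
    refine this.mono (by fun_prop) (ae_of_all _ fun x => by simp)
  obtain ⟨hint, heq⟩ := integral_trace_mul_transpose_pow (μ := μ) (X := X)
    (φ := fun m => ∫ x, x ^ m ∂ν)
    (fun m => Integrable.fintype_prod (f := fun e (x : ℝ) => x ^ m e) fun e => hpow (m e))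
    (fun m => integral_fintype_prod_eq_prod (fun e (x : ℝ) => x ^ m e)) k
  rw [← heq]
  obtain ⟨s, hs2, hcard, hnet⟩ := exists_finset_net (EuclideanSpace ℝ (Fin r))
  rw [finrank_euclideanSpace_fin] at hcard
  set Z : EuclideanSpace ℝ (Fin r) → EuclideanSpace ℝ (Fin r) → (Fin r × Fin r → ℝ) → ℝ :=
    fun x y ω => ∑ e : Fin r × Fin r, x e.1 * y e.2 * ω e with hZ
  have hpt (ω : Fin r × Fin r → ℝ) : trace ((X ω * (X ω)ᵀ) ^ k) ≤
      r * ∑ x ∈ s, ∑ y ∈ s, Z x y ω ^ (2 * k) := by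
    refine (trace_mul_transpose_pow_le _ k hk).trans ?_
    gcongr
    refine pow_le_sum_sum_pow_of_forall_abs_le s (fun x y => Z x y ω) (norm_nonneg _) ?_ hk
    intro M hM
    exact spectralNorm2_le_of_net _ hnet hM
  have hentry (e : Fin r × Fin r) : HasSubgaussianMGF (fun ω : Fin r × Fin r → ℝ => ω e) c μ := by
    refine HasSubgaussianMGF.of_map (X := id) (Y := fun ω : Fin r × Fin r → ℝ => ω e)
      (measurable_pi_apply e).aemeasurable ?_
    rwa [hμ, (measurePreserving_eval _ e).map_eq]
  have hindep : iIndepFun (fun (e : Fin r × Fin r) (ω : Fin r × Fin r → ℝ) => ω e) μ :=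
    iIndepFun_pi (X := fun _ => id) fun _ => aemeasurable_id
  have hsub (x y : EuclideanSpace ℝ (Fin r)) (hx : ‖x‖ ≤ 2) (hy : ‖y‖ ≤ 2) :
      ∃ d : ℝ≥0, d ≤ 16 * c ∧ HasSubgaussianMGF (Z x y) d μ := by
    refine ⟨_, ?_, HasSubgaussianMGF.sum_of_iIndepFun (s := Finset.univ)
      (hindep.comp (fun e z => x e.1 * y e.2 * z) fun e => by fun_prop)
      fun e _ => (hentry e).const_mul (x e.1 * y e.2)⟩
    rw [← NNReal.coe_le_coe]
    rw [NNReal.coe_sum]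
    refine (Finset.sum_congr rfl fun e _ =>
      (rfl : _ = (x e.1 * y e.2) ^ 2 * (c : ℝ))).trans_le ?_
    rw [← Finset.sum_mul]
    push_cast
    gcongr
    have h1 : ∑ e : Fin r × Fin r, (x e.1 * y e.2) ^ 2 = ‖x‖ ^ 2 * ‖y‖ ^ 2 := by
      rw [EuclideanSpace.norm_sq_eq, EuclideanSpace.norm_sq_eq, Finset.sum_mul_sum,
        Fintype.sum_prod_type]
      simp [mul_pow]
    calc ∑ e : Fin r × Fin r, (x e.1 * y e.2) ^ 2 = ‖x‖ ^ 2 * ‖y‖ ^ 2 := h1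
      _ ≤ 2 ^ 2 * 2 ^ 2 := by gcongr
      _ = 16 := by norm_num
  have hk0 : (0 : ℝ) < k := by exact_mod_cast Nat.pos_of_ne_zero hk
  have hmom (x y : EuclideanSpace ℝ (Fin r)) (hx : ‖x‖ ≤ 2) (hy : ‖y‖ ≤ 2) :
      Integrable (fun ω => Z x y ω ^ (2 * k)) μ ∧
      ∫ ω, Z x y ω ^ (2 * k) ∂μ ≤ 2 * (4 * Real.exp (8 * c) * k) ^ k := by
    obtain ⟨d, hd, hsg⟩ := hsub x y hx hy
    constructor
    · have := (hsg.memLp (2 * k : ℕ)).integrable_norm_pow'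
      refine this.mono (hsg.aemeasurable.pow_const _).aestronglyMeasurable
        (ae_of_all _ fun ω => by simp)
    -- The choice `t = √k` balances `(2k)! / t ^ (2k)` against the exponential factor: both are then
    -- of the form `const ^ k`, up to `k ^ k`.
    · refine (hsg.integral_pow_le k (Real.sqrt_pos.2 hk0)).trans ?_
      have hd' : (d : ℝ) ≤ 16 * c := by exact_mod_cast hd
      have hfac : ((2 * k).factorial : ℝ) ≤ (2 * k : ℝ) ^ (2 * k) := by
        exact_mod_cast Nat.factorial_le_pow (2 * k)
      rw [pow_mul √(k : ℝ), Real.sq_sqrt hk0.le]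
      calc ((2 * k).factorial : ℝ) / (k : ℝ) ^ k * (2 * Real.exp (d * k / 2))
          ≤ (2 * k : ℝ) ^ (2 * k) / (k : ℝ) ^ k * (2 * Real.exp (16 * c * k / 2)) := by gcongr
        _ = 2 * (4 * Real.exp (8 * c) * k) ^ k := by
            have : Real.exp (16 * c * k / 2) = Real.exp (8 * c) ^ k := by
              rw [← Real.exp_nat_mul]; ring_nf
            rw [this, pow_mul, show (2 * k : ℝ) ^ 2 = (4 * k) * k by ring]
            simp only [mul_pow]
            field_simp
  have hmem := fun x (hx : x ∈ s) y (hy : y ∈ s) => hmom x y (hs2 x hx) (hs2 y hy)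
  calc ∫ ω, trace ((X ω * (X ω)ᵀ) ^ k) ∂μ
      ≤ ∫ ω, r * ∑ x ∈ s, ∑ y ∈ s, Z x y ω ^ (2 * k) ∂μ :=
        integral_mono hint ((integrable_finsetSum _ fun x hx => integrable_finsetSum _ fun y hy =>
          (hmem x hx y hy).1).const_mul _) hpt
    _ = r * ∑ x ∈ s, ∑ y ∈ s, ∫ ω, Z x y ω ^ (2 * k) ∂μ := by
        rw [integral_const_mul, integral_finsetSum _ fun x hx => integrable_finsetSum _ fun y hy =>
          (hmem x hx y hy).1]
        congr 1
        exact Finset.sum_congr rfl fun x hx => integral_finsetSum _ fun y hy => (hmem x hx y hy).1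
    _ ≤ r * ∑ x ∈ s, ∑ y ∈ s, 2 * (4 * Real.exp (8 * c) * k) ^ k := by
        gcongr with x hx y hy
        exact (hmem x hx y hy).2
    _ = r * (s.card * (s.card * (2 * (4 * Real.exp (8 * c) * k) ^ k))) := by
        simp only [Finset.sum_const, nsmul_eq_mul]
    _ ≤ (2 * k) * (5 ^ (2 * k) * (5 ^ (2 * k) * (2 * (4 * Real.exp (8 * c) * k) ^ k))) := by
        have : (s.card : ℝ) ≤ 5 ^ (2 * k) := by exact_mod_cast hcard
        have hr : (r : ℝ) = 2 * k := by simp [r]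
        rw [hr]
        gcongr
    _ = (4 * k) * (2500 * Real.exp (8 * c) * k) ^ k := by
        rw [show (2500 * Real.exp (8 * c) * k) = 5 ^ 2 * (5 ^ 2 * (4 * Real.exp (8 * c) * k)) by ring,
          mul_pow (5 ^ 2), mul_pow (5 ^ 2), pow_mul]
        ring
    _ ≤ 4 ^ k * (2500 * Real.exp (8 * c) * k) ^ k := by
        gcongr
        have : 4 * k ≤ 4 ^ k := by
          obtain ⟨l, rfl⟩ := Nat.exists_eq_succ_of_ne_zero hk
          have := Nat.lt_pow_self (n := l) (a := 4) (by norm_num)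
          rw [Nat.succ_eq_add_one, pow_succ]
          omega
        exact_mod_cast this
    _ = _ := by rw [← mul_pow]; ring_nf

end Dense

/-! ### Moments of the matrix entries -/

section Moments

theorem eLpNorm_le_of_subGaussianNorm_le {Ω : Type*} [MeasurableSpace Ω] {μ : Measure Ω}
    {ξ : Ω → ℝ} {K : ℝ≥0} (h : subGaussianNorm ξ μ ≤ K) {m : ℕ} (hm : m ≠ 0) :
    eLpNorm ξ m μ ≤ K * (m : ℝ≥0∞) ^ (1 / 2 : ℝ) := by
  have h1 : (m : ℝ≥0∞) ^ (-(1 / 2) : ℝ) * eLpNorm ξ m μ ≤ K :=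
    (le_iSup₂ (f := fun (k : ℕ) (_ : 1 ≤ k) =>
      (k : ℝ≥0∞) ^ (-(1 / 2) : ℝ) * eLpNorm ξ (k : ℝ≥0∞) μ) m (Nat.one_le_iff_ne_zero.2 hm)).trans h
  have hm0 : (m : ℝ≥0∞) ≠ 0 := by exact_mod_cast hm
  have h2 : (m : ℝ≥0∞) ^ (1 / 2 : ℝ) * (m : ℝ≥0∞) ^ (-(1 / 2) : ℝ) = 1 := by
    rw [← ENNReal.rpow_add _ _ hm0 (ENNReal.natCast_ne_top m)]
    simp
  calc eLpNorm ξ m μ = (m : ℝ≥0∞) ^ (1 / 2 : ℝ) *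
        ((m : ℝ≥0∞) ^ (-(1 / 2) : ℝ) * eLpNorm ξ m μ) := by rw [← mul_assoc, h2, one_mul]
    _ ≤ (m : ℝ≥0∞) ^ (1 / 2 : ℝ) * K := by gcongr
    _ = _ := mul_comm _ _

theorem integrable_pow_of_subGaussianNorm_le {Ω : Type*} [MeasurableSpace Ω] {μ : Measure Ω}
    [IsFiniteMeasure μ] {ξ : Ω → ℝ} (hξ : Measurable ξ) {K : ℝ≥0} (h : subGaussianNorm ξ μ ≤ K)
    (m : ℕ) : Integrable (fun ω => ξ ω ^ m) μ := by
  rcases eq_or_ne m 0 with rfl | hm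
  · simp
  have hmem : MemLp ξ m μ := by
    refine ⟨hξ.aestronglyMeasurable, (eLpNorm_le_of_subGaussianNorm_le h hm).trans_lt ?_⟩
    exact ENNReal.mul_lt_top ENNReal.coe_lt_top
      (ENNReal.rpow_lt_top_of_nonneg (by norm_num) (ENNReal.natCast_ne_top m))
  exact hmem.integrable_norm_pow'.mono (hξ.pow_const m).aestronglyMeasurable
    (ae_of_all _ fun ω => by simp)

theorem abs_integral_pow_le_of_subGaussianNorm_le {Ω : Type*} [MeasurableSpace Ω] {μ : Measure Ω}
    {ξ : Ω → ℝ} {K : ℝ≥0} (h : subGaussianNorm ξ μ ≤ K) {m : ℕ} (hm : m ≠ 0) :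
    |∫ ω, ξ ω ^ m ∂μ| ≤ (K * √m) ^ m := by
  have h1 : ‖∫ ω, ξ ω ^ m ∂μ‖ₑ ≤ eLpNorm ξ m μ ^ m := by
    refine (enorm_integral_le_lintegral_enorm _).trans ?_
    have := eLpNorm_nnreal_pow_eq_lintegral (f := ξ) (μ := μ) (p := (m : ℝ≥0)) (by exact_mod_cast hm)
    simp only [NNReal.coe_natCast, ENNReal.rpow_natCast, ENNReal.coe_natCast] at this
    rw [this]
    simp [enorm_pow]
  have h2 := h1.trans (pow_le_pow_left' (eLpNorm_le_of_subGaussianNorm_le h hm) m)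
  have h3 : ((K : ℝ≥0∞) * (m : ℝ≥0∞) ^ (1 / 2 : ℝ)) ^ m = ENNReal.ofReal ((K * √m) ^ m) := by
    rw [ENNReal.ofReal_pow (by positivity), ENNReal.ofReal_mul (by positivity),
      ENNReal.ofReal_coe_nnreal, Real.sqrt_eq_rpow,
      ← ENNReal.ofReal_rpow_of_nonneg (by positivity) (by norm_num), ENNReal.ofReal_natCast]
  rw [h3, ← ofReal_norm, ENNReal.ofReal_le_ofReal_iff (by positivity)] at h2
  simpa using h2

theorem integral_pow_bernoulliMeasure (p : unitInterval) {m : ℕ} (hm : m ≠ 0) :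
    ∫ x, x ^ m ∂(bernoulliMeasure (1 : ℝ) 0 p) = p := by
  rw [integral_bernoulliMeasure]
  simp [hm]

theorem ProbabilityTheory.iIndepFun.integrable_fun_prod_comp {Ω ι : Type*} [MeasurableSpace Ω]
    [Fintype ι] {μ : Measure Ω} {X : ι → Ω → ℝ} (hX : iIndepFun X μ) (mX : ∀ i, Measurable (X i))
    {f : ι → ℝ → ℝ} (mf : ∀ i, Measurable (f i)) (hf : ∀ i, Integrable (fun ω => f i (X i ω)) μ) :
    Integrable (fun ω => ∏ i, f i (X i ω)) μ := by
  have := hX.isProbabilityMeasure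
  have hpi : Integrable (fun x : ι → ℝ => ∏ i, f i (x i)) (μ.map fun ω i => X i ω) := by
    rw [hX.map_fun_eq_pi_map fun i => (mX i).aemeasurable]
    have (i : ι) : IsProbabilityMeasure (μ.map (X i)) :=
      Measure.isProbabilityMeasure_map (mX i).aemeasurable
    refine Integrable.fintype_prod fun i => ?_
    rw [integrable_map_measure (mf i).aestronglyMeasurable (mX i).aemeasurable]
    exact hf i
  exact hpi.comp_measurable (measurable_pi_lambda _ mX)

/-- The mixed moments of the entries of a sparse matrix. -/
theorem sparseMatrix_mixed_moments {n : ℕ} {p : unitInterval} {K : ℝ≥0} {Ω : Type*}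
    [MeasurableSpace Ω] {μ : Measure Ω} [IsProbabilityMeasure μ] {δ ξ : Fin n → Fin n → Ω → ℝ}
    (hδm : ∀ i j, Measurable (δ i j)) (hξm : ∀ i j, Measurable (ξ i j))
    (hind : iIndepFun (Sum.elim (fun q : Fin n × Fin n => δ q.1 q.2)
      (fun q : Fin n × Fin n => ξ q.1 q.2)) μ)
    (hδ : ∀ i j, HasLaw (δ i j) (bernoulliMeasure (1 : ℝ) 0 p) μ)
    (hid : ∀ i j i' j', IdentDistrib (ξ i j) (ξ i' j') μ μ)
    (hK : ∀ i j, subGaussianNorm (ξ i j) μ ≤ K) (i₀ : Fin n) (m : Fin n × Fin n → ℕ) :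
    Integrable (fun ω => ∏ e : Fin n × Fin n, sparseMatrix δ ξ ω e.1 e.2 ^ m e) μ ∧
    ∫ ω, ∏ e : Fin n × Fin n, sparseMatrix δ ξ ω e.1 e.2 ^ m e ∂μ =
      ∏ e, (∫ x, x ^ m e ∂(bernoulliMeasure (1 : ℝ) 0 p)) * ∫ ω, ξ i₀ i₀ ω ^ m e ∂μ := by
  set Y : (Fin n × Fin n) ⊕ (Fin n × Fin n) → Ω → ℝ := Sum.elim (fun q => δ q.1 q.2)
    (fun q => ξ q.1 q.2) with hY
  set f : (Fin n × Fin n) ⊕ (Fin n × Fin n) → ℝ → ℝ := fun i x => x ^ Sum.elim m m i with hf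
  have mY (i) : Measurable (Y i) := by
    rcases i with q | q
    · exact hδm _ _
    · exact hξm _ _
  have heq (ω : Ω) : ∏ e : Fin n × Fin n, sparseMatrix δ ξ ω e.1 e.2 ^ m e =
      ∏ i, f i (Y i ω) := by
    rw [Fintype.prod_sum_type, ← Finset.prod_mul_distrib]
    simp [hf, hY, sparseMatrix, mul_pow]
  have hδint (i j : Fin n) (a : ℕ) : Integrable (fun ω => δ i j ω ^ a) μ := by
    have h1 : Integrable (fun x : ℝ => x ^ a) (μ.map (δ i j)) := by
      rw [(hδ i j).map_eq]
      exact integrable_bernoulliMeasure _ _ _ _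
    exact h1.comp_measurable (hδm i j)
  simp_rw [heq]
  constructor
  · refine hind.integrable_fun_prod_comp mY (fun i => by fun_prop) fun i => ?_
    rcases i with q | q
    · exact hδint _ _ _
    · exact integrable_pow_of_subGaussianNorm_le (hξm _ _) (hK _ _) _
  · rw [hind.integral_fun_prod_comp (fun i => (mY i).aemeasurable) fun i =>
      (by fun_prop : Measurable (f i)).aestronglyMeasurable, Fintype.prod_sum_type,
      ← Finset.prod_mul_distrib]
    refine Finset.prod_congr rfl fun e _ => ?_
    congr 1
    · rw [← (hδ e.1 e.2).map_eq, integral_map (hδm _ _).aemeasurable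
        (by fun_prop : Measurable fun x : ℝ => x ^ m e).aestronglyMeasurable]
      rfl
    · exact ((hid e.1 e.2 i₀ i₀).comp (measurable_id.pow_const (m e))).integral_eq

end Moments

/-! ### Tail bound for the sparse matrix -/

section Sparse

open Matrix

/-- Bound for the moments of the singular values of a sparse matrix, in terms of a reference law
`ν` that is sub-Gaussian with large moments. -/
theorem integral_trace_sparseMatrix_le {ν : Measure ℝ} [IsProbabilityMeasure ν] {c : ℝ≥0}
    (hν : HasSubgaussianMGF id c ν) (hν1 : ∫ x, x ∂ν = 0)
    (hνm : ∀ m : ℕ, 2 ≤ m → (√m / 16) ^ m ≤ ∫ x, x ^ m ∂ν)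
    {n : ℕ} {p : unitInterval} {K : ℝ≥0} {Ω : Type*} (hn : n ≠ 0) (hp : 0 < (p : ℝ))
    [MeasurableSpace Ω] {μ : Measure Ω} [IsProbabilityMeasure μ] {δ ξ : Fin n → Fin n → Ω → ℝ}
    (hδm : ∀ i j, Measurable (δ i j)) (hξm : ∀ i j, Measurable (ξ i j))
    (hind : iIndepFun (Sum.elim (fun q : Fin n × Fin n => δ q.1 q.2)
      (fun q : Fin n × Fin n => ξ q.1 q.2)) μ)
    (hδ : ∀ i j, HasLaw (δ i j) (bernoulliMeasure (1 : ℝ) 0 p) μ)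
    (hid : ∀ i j i' j', IdentDistrib (ξ i j) (ξ i' j') μ μ)
    (hmean : ∀ i j, ∫ ω, ξ i j ω ∂μ = 0)
    (hK : ∀ i j, subGaussianNorm (ξ i j) μ ≤ K) {k : ℕ} (hk : k ≠ 0) (hnk : n * (p : ℝ) ≤ k) :
    Integrable (fun ω => trace ((sparseMatrix δ ξ ω * (sparseMatrix δ ξ ω)ᵀ) ^ k)) μ ∧
    ∫ ω, trace ((sparseMatrix δ ξ ω * (sparseMatrix δ ξ ω)ᵀ) ^ k) ∂μ ≤
      (p : ℝ)⁻¹ * (2560000 * K ^ 2 * Real.exp (8 * c) * k) ^ k := by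
  have i₀ : Fin n := ⟨0, Nat.pos_of_ne_zero hn⟩
  have hmix := sparseMatrix_mixed_moments hδm hξm hind hδ hid hK i₀
  obtain ⟨hint, heq⟩ := integral_trace_mul_transpose_pow (μ := μ) (X := sparseMatrix δ ξ)
    (φ := fun m => (∫ x, x ^ m ∂(bernoulliMeasure (1 : ℝ) 0 p)) * ∫ ω, ξ i₀ i₀ ω ^ m ∂μ)
    (fun m => (hmix m).1) (fun m => (hmix m).2) k
  refine ⟨hint, ?_⟩
  rw [heq]
  have hψn (m : ℕ) : 0 ≤ ∫ x, x ^ m ∂ν := by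
    rcases Nat.lt_or_ge m 2 with hm | hm
    · interval_cases m
      · simp
      · simp [hν1]
    · exact (by positivity : (0 : ℝ) ≤ (√m / 16) ^ m).trans (hνm m hm)
  -- The scale `κ = 16 K` turns the lower bound `(√m / 16) ^ m` for the reference moments into the
  -- upper bound `(K √m) ^ m` for those of `ξ`. For `m = 1` both moments vanish.
  refine (sum_walkWeight_le (R := Fin (2 * k)) (ψ := fun m => ∫ x, x ^ m ∂ν) (p := p)
    (κ := 16 * K) hp p.2.2 (by simp) (by simp) hψn ?_ hk (by simpa using hnk) (by simp)).trans ?_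
  · intro m hm
    simp only [integral_pow_bernoulliMeasure p hm]
    rcases eq_or_ne m 1 with rfl | hm1
    · simp [hmean, hν1]
    rw [abs_mul, abs_of_pos hp, mul_assoc]
    gcongr
    calc |∫ ω, ξ i₀ i₀ ω ^ m ∂μ| ≤ (K * √m) ^ m :=
          abs_integral_pow_le_of_subGaussianNorm_le (hK _ _) hm
      _ = (16 * K) ^ m * (√m / 16) ^ m := by rw [← mul_pow]; ring
      _ ≤ _ := by
          gcongr
          exact hνm m (by omega)
  · calc _ ≤ (p : ℝ)⁻¹ * (16 * K) ^ (2 * k) * (10000 * Real.exp (8 * c) * k) ^ k := by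
          gcongr
          exact sum_walkWeight_le_of_subgaussian hν hk
      _ = _ := by
          rw [pow_mul, mul_assoc, ← mul_pow]
          ring

theorem measureReal_spectralNorm2_sparseMatrix_ge_le_of_two_le {ν : Measure ℝ}
    [IsProbabilityMeasure ν] {c : ℝ≥0}
    (hν : HasSubgaussianMGF id c ν) (hν1 : ∫ x, x ∂ν = 0)
    (hνm : ∀ m : ℕ, 2 ≤ m → (√m / 16) ^ m ≤ ∫ x, x ^ m ∂ν)
    {n : ℕ} {p : unitInterval} {K : ℝ≥0} {Ω : Type*} (hn : 2 ≤ n) (hp : 0 < (p : ℝ))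
    (hpn : 2 * (Real.log n / n) ≤ p)
    [MeasurableSpace Ω] {μ : Measure Ω} [IsProbabilityMeasure μ] {δ ξ : Fin n → Fin n → Ω → ℝ}
    (hδm : ∀ i j, Measurable (δ i j)) (hξm : ∀ i j, Measurable (ξ i j))
    (hind : iIndepFun (Sum.elim (fun q : Fin n × Fin n => δ q.1 q.2)
      (fun q : Fin n × Fin n => ξ q.1 q.2)) μ)
    (hδ : ∀ i j, HasLaw (δ i j) (bernoulliMeasure (1 : ℝ) 0 p) μ)
    (hid : ∀ i j i' j', IdentDistrib (ξ i j) (ξ i' j') μ μ)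
    (hmean : ∀ i j, ∫ ω, ξ i j ω ∂μ = 0)
    (hK : ∀ i j, subGaussianNorm (ξ i j) μ ≤ K) {C : ℝ} (hC : 0 < C)
    (hCK : 2 * Real.exp 2 * (2560000 * K ^ 2 * Real.exp (8 * c)) ≤ C ^ 2) :
    μ.real {ω | C * √((n : ℝ) * p) ≤ spectralNorm2 (sparseMatrix δ ξ ω)}
      ≤ Real.exp (-(n * p)) := by
  have hn0 : (0 : ℝ) < n := by exact_mod_cast (by omega : 0 < n)
  set D : ℝ := n * p with hD
  have hlogD : 2 * Real.log n ≤ D := by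
    have := mul_le_mul_of_nonneg_left hpn hn0.le
    calc 2 * Real.log n = n * (2 * (Real.log n / n)) := by field_simp
      _ ≤ D := this
  have hlog2 : Real.log 2 ≤ Real.log n :=
    Real.log_le_log (by norm_num) (by exact_mod_cast hn)
  -- This uses `n ≥ 2`: `np ≥ 2 log 2 > 1`. So there is a power of two `k` with `np ≤ k ≤ 2np`.
  have hD1 : 1 ≤ D := by linarith [Real.log_two_gt_d9]
  obtain ⟨s, hs1, hs2⟩ := exists_nat_pow_near hD1 (one_lt_two)
  set k : ℕ := 2 ^ (s + 1) with hk
  have hk0 : k ≠ 0 := by positivity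
  have hDk : D ≤ k := by rw [hk]; push_cast; exact hs2.le
  have hkD : (k : ℝ) ≤ 2 * D := by
    rw [hk]; push_cast; rw [pow_succ]; linarith
  obtain ⟨hint, hle⟩ := integral_trace_sparseMatrix_le hν hν1 hνm (by omega) hp hδm hξm hind hδ hid
    hmean hK hk0 hDk
  set G : ℝ := 2560000 * K ^ 2 * Real.exp (8 * c) with hG
  have hG0 : 0 ≤ G := by positivity
  -- The factor `p⁻¹` lost in the comparison costs at most `e ^ k`, since `log n ≤ np / 2 ≤ k`.
  have hpinv : (p : ℝ)⁻¹ ≤ Real.exp 1 ^ k := by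
    calc (p : ℝ)⁻¹ = n / D := by rw [hD]; field_simp
      _ ≤ n := div_le_self hn0.le hD1
      _ = Real.exp (Real.log n) := (Real.exp_log hn0).symm
      _ ≤ Real.exp k := Real.exp_le_exp.2 (by linarith [Real.log_two_gt_d9])
      _ = Real.exp 1 ^ k := by rw [← Real.exp_nat_mul, mul_one]
  have hbound : ∫ ω, trace ((sparseMatrix δ ξ ω * (sparseMatrix δ ξ ω)ᵀ) ^ k) ∂μ ≤
      Real.exp (-k) * (C ^ 2 * D) ^ k := by
    refine hle.trans ?_
    calc (p : ℝ)⁻¹ * (G * k) ^ k ≤ Real.exp 1 ^ k * (G * (2 * D)) ^ k := by gcongr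
      -- Of the factor `e ^ 2` built into `C ^ 2`, one `e` cancels `p⁻¹` and the other produces the
      -- decay `e ^ (-k)`.
      _ = Real.exp (-1) ^ k * (2 * Real.exp 2 * G * D) ^ k := by
          rw [← mul_pow, ← mul_pow]
          have : Real.exp 1 = Real.exp (-1) * Real.exp 2 := by rw [← Real.exp_add]; norm_num
          rw [this]; ring
      _ ≤ Real.exp (-1) ^ k * (C ^ 2 * D) ^ k := by gcongr
      _ = _ := by rw [← Real.exp_nat_mul]; ring_nf
  have hpow (A : Matrix (Fin n) (Fin n) ℝ) : 0 ≤ trace ((A * Aᵀ) ^ k) :=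
    (pow_nonneg (norm_nonneg _) _).trans (spectralNorm2_pow_le_trace A s)
  have hmarkov := mul_meas_ge_le_integral_of_nonneg (ae_of_all μ fun ω =>
    hpow (sparseMatrix δ ξ ω)) hint ((C ^ 2 * D) ^ k)
  have hsub : {ω | C * √D ≤ spectralNorm2 (sparseMatrix δ ξ ω)} ⊆
      {ω | (C ^ 2 * D) ^ k ≤ trace ((sparseMatrix δ ξ ω * (sparseMatrix δ ξ ω)ᵀ) ^ k)} := by
    intro ω hω
    refine le_trans ?_ (spectralNorm2_pow_le_trace _ s)
    calc (C ^ 2 * D) ^ k = (C * √D) ^ (2 * k) := by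
          rw [pow_mul, mul_pow C, Real.sq_sqrt (by linarith)]
      _ ≤ _ := pow_le_pow_left₀ (by positivity) hω _
  refine (measureReal_mono hsub).trans ?_
  have hpos : 0 < (C ^ 2 * D) ^ k := by positivity
  refine le_trans (le_of_mul_le_mul_left ?_ hpos) (Real.exp_le_exp.2 (neg_le_neg hDk))
  rw [mul_comm _ (Real.exp _)]
  exact hmarkov.trans hbound

/-- For `n = 1` the condition `p ≥ C₀ log n / n` says nothing, so `p⁻¹` cannot be absorbed. The
second moment suffices instead: it carries its own factor `p`, and a bound by `e⁻¹ ≤ e ^ (-p)` is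
enough. -/
theorem measureReal_spectralNorm2_sparseMatrix_ge_le_of_one
    {p : unitInterval} {K : ℝ≥0} {Ω : Type*} (hp : 0 < (p : ℝ))
    [MeasurableSpace Ω] {μ : Measure Ω} [IsProbabilityMeasure μ] {δ ξ : Fin 1 → Fin 1 → Ω → ℝ}
    (hδm : ∀ i j, Measurable (δ i j)) (hξm : ∀ i j, Measurable (ξ i j))
    (hind : iIndepFun (Sum.elim (fun q : Fin 1 × Fin 1 => δ q.1 q.2)
      (fun q : Fin 1 × Fin 1 => ξ q.1 q.2)) μ)
    (hδ : ∀ i j, HasLaw (δ i j) (bernoulliMeasure (1 : ℝ) 0 p) μ)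
    (hid : ∀ i j i' j', IdentDistrib (ξ i j) (ξ i' j') μ μ)
    (hK : ∀ i j, subGaussianNorm (ξ i j) μ ≤ K) {C : ℝ} (hC : 0 < C)
    (hCK : 2 * Real.exp 1 * K ^ 2 ≤ C ^ 2) :
    μ.real {ω | C * √(p : ℝ) ≤ spectralNorm2 (sparseMatrix δ ξ ω)} ≤ Real.exp (-p) := by
  obtain ⟨hint, heq⟩ := sparseMatrix_mixed_moments hδm hξm hind hδ hid hK 0 fun _ => 2
  simp only [Fintype.prod_prod_type, Finset.univ_unique, Finset.prod_singleton,
    integral_pow_bernoulliMeasure p two_ne_zero] at hint heq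
  have hle : ∫ ω, ξ 0 0 ω ^ 2 ∂μ ≤ 2 * K ^ 2 := by
    refine (le_abs_self _).trans
      ((abs_integral_pow_le_of_subGaussianNorm_le (hK 0 0) two_ne_zero).trans_eq ?_)
    rw [mul_pow]
    norm_num
    ring
  have hmarkov := mul_meas_ge_le_integral_of_nonneg (ae_of_all μ fun ω =>
    sq_nonneg (sparseMatrix δ ξ ω default default)) hint (C ^ 2 * p)
  have hsub : {ω | C * √(p : ℝ) ≤ spectralNorm2 (sparseMatrix δ ξ ω)} ⊆
      {ω | C ^ 2 * (p : ℝ) ≤ sparseMatrix δ ξ ω default default ^ 2} := by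
    intro ω hω
    have h := spectralNorm2_sq_le_sum_sq (sparseMatrix δ ξ ω)
    simp only [Finset.univ_unique, Finset.sum_singleton] at h
    refine le_trans ?_ h
    calc C ^ 2 * (p : ℝ) = (C * √(p : ℝ)) ^ 2 := by rw [mul_pow C, Real.sq_sqrt hp.le]
      _ ≤ _ := pow_le_pow_left₀ (by positivity) hω _
  refine (measureReal_mono hsub).trans ?_
  have hpos : 0 < C ^ 2 * (p : ℝ) := by positivity
  refine le_trans (le_of_mul_le_mul_left ?_ hpos) (Real.exp_le_exp.2 (neg_le_neg p.2.2))
  refine hmarkov.trans (heq.trans_le ?_)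
  have h1 : 2 * K ^ 2 ≤ C ^ 2 * Real.exp (-1) := by
    rw [Real.exp_neg, ← div_eq_mul_inv, le_div_iff₀ (Real.exp_pos 1)]
    linarith
  calc (p : ℝ) * ∫ ω, ξ 0 0 ω ^ 2 ∂μ ≤ p * (C ^ 2 * Real.exp (-1)) := by
        gcongr
        exact hle.trans h1
    _ = _ := by ring

end Sparse

theorem theorem1p7 :
    ∃ C₀ : ℝ, 1 ≤ C₀ ∧
      ∀ K : ℝ≥0, ∃ C : ℝ, 0 < C ∧ ∃ c : ℝ, 0 < c ∧
        ∀ (n : ℕ) (p : unitInterval), 1 ≤ n → 0 < (p : ℝ) →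
          C₀ * (Real.log n / n) ≤ (p : ℝ) →
        ∀ {Ω : Type*} [MeasurableSpace Ω] (μ : Measure Ω) [IsProbabilityMeasure μ]
          (δ ξ : Fin n → Fin n → Ω → ℝ),
          (∀ i j, Measurable (δ i j)) → (∀ i j, Measurable (ξ i j)) →
          -- all the variables `δ i j` and `ξ i j` are mutually independent
          iIndepFun (Sum.elim (fun q : Fin n × Fin n => δ q.1 q.2)
            (fun q : Fin n × Fin n => ξ q.1 q.2)) μ →
          -- each `δ i j` is 1 with probability `p` and 0 with probability `1 - p`
          (∀ i j, HasLaw (δ i j) (bernoulliMeasure (1 : ℝ) 0 p) μ) →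
          (∀ i j i' j', IdentDistrib (ξ i j) (ξ i' j') μ μ) →
          (∀ i j, ∫ ω, ξ i j ω ∂μ = 0) →
          (∀ i j, subGaussianNorm (ξ i j) μ ≤ K) →
          μ.real {ω | C * √((n : ℝ) * p) ≤ spectralNorm2 (sparseMatrix δ ξ ω)}
            ≤ Real.exp (-(c * n * p)) := by
  obtain ⟨ν, c, hprob, hν, hν1, hνm⟩ := exists_centered_subgaussian_law_moment_ge
  refine ⟨2, one_le_two, fun K => ?_⟩
  set G : ℝ := 2 * Real.exp 2 * (2560000 * K ^ 2 * Real.exp (8 * c)) with hG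
  have hG0 : 0 ≤ G := by positivity
  have hC2 : √(G + 1) ^ 2 = G + 1 := Real.sq_sqrt (by positivity)
  -- The `+ 1` keeps `C` positive when `K = 0`.
  refine ⟨√(G + 1), Real.sqrt_pos.2 (by positivity), 1, one_pos, ?_⟩
  intro n p hn hp hpn Ω _ μ _ δ ξ hδm hξm hind hδ hid hmean hK
  rcases hn.eq_or_lt with rfl | hn2
  · have hKG : 2 * Real.exp 1 * (K : ℝ) ^ 2 ≤ G := by
      have h1 : Real.exp 1 ≤ Real.exp 2 := Real.exp_le_exp.2 (by norm_num)
      have h2 : (1 : ℝ) ≤ Real.exp (8 * c) := Real.one_le_exp (by positivity)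
      calc 2 * Real.exp 1 * (K : ℝ) ^ 2 = 2 * Real.exp 1 * (1 * K ^ 2 * 1) := by ring
        _ ≤ G := by rw [hG]; gcongr; norm_num
    simpa using measureReal_spectralNorm2_sparseMatrix_ge_le_of_one hp hδm hξm hind hδ hid hK
      (Real.sqrt_pos.2 (by positivity)) (by rw [hC2]; linarith)
  · simpa using measureReal_spectralNorm2_sparseMatrix_ge_le_of_two_le hν hν1 hνm hn2 hp hpn hδm hξm
      hind hδ hid hmean hK (Real.sqrt_pos.2 (by positivity : 0 < G + 1)) (by rw [hC2]; linarith)
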